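/- Let $\alpha>1$, let $(M^m,g)$ be a compact smooth Riemannian manifold without boundary with $m>2$, let $(N^n,h)$ be a smooth Riemannian manifold, and let $\psi:M\to N$ be a smooth map that is non-degenerate, i.e. $\ker d\psi_x=\{0\}$ for every $x\in M$. Write $|d\psi|^2$ for the squared Hilbert–Schmidt norm of $d\psi$ with respect to $g$ and $h$. Call $\psi$ $\alpha$-harmonic (with respect to $g$) if it is a critical point, under smooth variations, of the $\alpha$-energy $$E_\alpha(\psi)=\int_M(1+|d\psi|^2)^\alpha\,dV_g ,$$ and harmonic with respect to a metric $\tilde g$ on $M$ if it is a critical point of the energy $E(\psi)=\frac12\int_M|d\psi|_{\tilde g}^2\,dV_{\tilde g}$. Let $\tau_{\tilde g}(\psi)=\operatorname{tr}_{\tilde g}\nabla d\psi$ be the tension field of $\psi:(M,\tilde g)\to(N,h)$, and let $$\tau_\alpha(\psi)=2\alpha(1+|d\psi|^2)^{\alpha-1}\tau_g(\psi)+d\psi\bigl(\operatorname{grad}_g(2\alpha(1+|d\psi|^2)^{\alpha-1})\bigr)$$ be the $\alpha$-tension field. Then $$\bar g=(2\alpha)^{\frac{2}{m-2}}\,(1+|d\psi|^2)^{\frac{2\alpha-2}{m-2}}\;g$$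 is a smooth Riemannian metric on $M$, and $\psi:(M,g)\to(N,h)$ is $\alpha$-harmonic if and only if $\psi:(M,\bar g)\to(N,h)$ is harmonic. Likewise, in terms of the Euler–Lagrange equations, $\tau_\alpha(\psi)=0$ on $M$ if and only if $\tau_{\bar g}(\psi)=0$ on $M$. -/

import Mathlib

open MeasureTheory Manifold Bundle
open scoped ContDiff

noncomputable section

namespace AlphaHarmonic

/-- A smooth Riemannian metric on the tangent bundle of a smooth `m`-dimensional manifold
(without boundary). -/
abbrev SmoothMetric (m : ℕ) (M : Type*) [TopologicalSpace M]
    [ChartedSpace (EuclideanSpace ℝ (Fin m)) M] [IsManifold (𝓡 m) ∞ M] :=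
  ContMDiffRiemannianMetric (𝓡 m) ∞ (EuclideanSpace ℝ (Fin m))
    (fun x : M => TangentSpace (𝓡 m) x)

section Pointwise

variable {m : ℕ} {M : Type*} [TopologicalSpace M]
  [ChartedSpace (EuclideanSpace ℝ (Fin m)) M]

/-- The `i`-th standard basis vector of `ℝᵐ`. -/
def stdVec (m : ℕ) (i : Fin m) : EuclideanSpace ℝ (Fin m) :=
  EuclideanSpace.single i 1

/-- The basis of the tangent space `T_x M` given by the standard basis vectors of `ℝᵐ`, with
which Mathlib identifies `T_x M` through the preferred chart at `x`. -/
def tangentVec (x : M) (i : Fin m) : TangentSpace (𝓡 m) x :=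
  stdVec m i

variable [IsManifold (𝓡 m) ∞ M]

/-- The Gram matrix of the metric at `x`, in the basis `tangentVec x` of `T_x M`. -/
def gram (g : SmoothMetric m M) (x : M) : Matrix (Fin m) (Fin m) ℝ :=
  Matrix.of fun i j => g.inner x (tangentVec x i) (tangentVec x j)

/-- The gradient of `f`: the vector dual to `df` with respect to `g`. -/
def grad (g : SmoothMetric m M) (f : M → ℝ) (x : M) : TangentSpace (𝓡 m) x :=
  ∑ i, ∑ j, ((gram g x)⁻¹ i j *
    (show ℝ from mfderiv (𝓡 m) 𝓘(ℝ, ℝ) f x (tangentVec x i))) • tangentVec x j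

end Pointwise

section Volume

variable {m : ℕ} {M : Type*} [TopologicalSpace M]
  [ChartedSpace (EuclideanSpace ℝ (Fin m)) M] [IsManifold (𝓡 m) ∞ M]

/-- The coordinate vector `∂_i` of the chart at `p`, at the point with coordinates `y`: the image of
the `i`-th standard basis vector under the differential of the inverse of the chart. -/
def coordVec (m : ℕ) {M : Type*} [TopologicalSpace M]
    [ChartedSpace (EuclideanSpace ℝ (Fin m)) M] (p : M) (y : EuclideanSpace ℝ (Fin m))
    (i : Fin m) : TangentSpace (𝓡 m) ((extChartAt (𝓡 m) p).symm y) :=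
  mfderiv (𝓡 m) (𝓡 m) (extChartAt (𝓡 m) p).symm y (tangentVec y i)

/-- The matrix `g_ij = g(∂_i, ∂_j)` of the metric in the chart at `p`, as a function of the point
`y` of the target of this chart. -/
def chartGram (g : SmoothMetric m M) (p : M) (y : EuclideanSpace ℝ (Fin m)) :
    Matrix (Fin m) (Fin m) ℝ :=
  Matrix.of fun i j =>
    g.inner ((extChartAt (𝓡 m) p).symm y) (coordVec m p y i) (coordVec m p y j)

/-- The measure `√(det g_ij) dy¹ ⋯ dyᵐ` of the chart at `p`, transported to `M`; it is carried by
the domain of this chart. -/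
def chartVolume [MeasurableSpace M] (g : SmoothMetric m M) (p : M) : Measure M :=
  ((volume.restrict (extChartAt (𝓡 m) p).target).withDensity
    (fun y => ENNReal.ofReal (Real.sqrt (chartGram g p y).det))).map
      (extChartAt (𝓡 m) p).symm

/-- A smooth partition of unity subordinate to the domains of the preferred charts. -/
def chartPartition (m : ℕ) (M : Type*) [TopologicalSpace M]
    [ChartedSpace (EuclideanSpace ℝ (Fin m)) M] [IsManifold (𝓡 m) ∞ M]
    [T2Space M] [SigmaCompactSpace M] :
    SmoothPartitionOfUnity M (𝓡 m) M Set.univ :=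
  (SmoothPartitionOfUnity.exists_isSubordinate_chartAt_source (𝓡 m) M).choose

/-- The Riemannian volume measure `dV_g`: the measures `√(det g_ij) dy¹ ⋯ dyᵐ` of the charts,
glued by a partition of unity. -/
def volumeMeasure [MeasurableSpace M] [T2Space M] [SigmaCompactSpace M]
    (g : SmoothMetric m M) : Measure M :=
  Measure.sum fun p : M =>
    (chartVolume g p).withDensity (fun x => ENNReal.ofReal (chartPartition m M p x))

end Volume

section Maps

variable {m n : ℕ}
  {M : Type*} [TopologicalSpace M] [ChartedSpace (EuclideanSpace ℝ (Fin m)) M]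
  {N : Type*} [TopologicalSpace N] [ChartedSpace (EuclideanSpace ℝ (Fin n)) N]

/-- A map is non-degenerate if its differential has trivial kernel at every point. -/
def NonDegenerate (m n : ℕ) {M : Type*} [TopologicalSpace M]
    [ChartedSpace (EuclideanSpace ℝ (Fin m)) M]
    {N : Type*} [TopologicalSpace N] [ChartedSpace (EuclideanSpace ℝ (Fin n)) N]
    (ψ : M → N) : Prop :=
  ∀ x : M, ∀ v : TangentSpace (𝓡 m) x, mfderiv (𝓡 m) (𝓡 n) ψ x v = 0 → v = 0

/-- A smooth variation of `ψ` with parameter in `(-ε, ε)`. -/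
structure IsVariation (m n : ℕ) {M : Type*} [TopologicalSpace M]
    [ChartedSpace (EuclideanSpace ℝ (Fin m)) M]
    {N : Type*} [TopologicalSpace N] [ChartedSpace (EuclideanSpace ℝ (Fin n)) N]
    (ψ : M → N) (ε : ℝ) (Ψ : ℝ × M → N) : Prop where
  pos : 0 < ε
  smooth : ContMDiffOn (𝓘(ℝ, ℝ).prod (𝓡 m)) (𝓡 n) ∞ Ψ (Set.Ioo (-ε) ε ×ˢ Set.univ)
  initial : ∀ x, Ψ (0, x) = ψ x

/-- `ψ` is a critical point of the functional `F`: the derivative of `F` along every smooth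
variation of `ψ` exists and vanishes at parameter `0`. -/
def IsCritical (m n : ℕ) {M : Type*} [TopologicalSpace M]
    [ChartedSpace (EuclideanSpace ℝ (Fin m)) M]
    {N : Type*} [TopologicalSpace N] [ChartedSpace (EuclideanSpace ℝ (Fin n)) N]
    (F : (M → N) → ℝ) (ψ : M → N) : Prop :=
  ∀ (ε : ℝ) (Ψ : ℝ × M → N), IsVariation m n ψ ε Ψ →
    HasDerivAt (fun t : ℝ => F (fun x => Ψ (t, x))) 0 0

variable [IsManifold (𝓡 m) ∞ M] [IsManifold (𝓡 n) ∞ N]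

/-- The squared Hilbert-Schmidt norm `|dψ|² = g^{ij} h(dψ e_i, dψ e_j)`. -/
def normSqDiff (g : SmoothMetric m M) (h : SmoothMetric n N) (ψ : M → N) (x : M) : ℝ :=
  ∑ i, ∑ j, (gram g x)⁻¹ i j *
    h.inner (ψ x) (mfderiv (𝓡 m) (𝓡 n) ψ x (tangentVec x i))
      (mfderiv (𝓡 m) (𝓡 n) ψ x (tangentVec x j))

/-- The energy `E(ψ) = 1/2 ∫_M |dψ|² dV_g`. -/
def energy [MeasurableSpace M] [T2Space M] [SigmaCompactSpace M]
    (g : SmoothMetric m M) (h : SmoothMetric n N) (ψ : M → N) : ℝ :=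
  (1 / 2) * ∫ x, normSqDiff g h ψ x ∂(volumeMeasure g)

/-- The `α`-energy `E_α(ψ) = ∫_M (1 + |dψ|²)^α dV_g`. -/
def alphaEnergy [MeasurableSpace M] [T2Space M] [SigmaCompactSpace M]
    (α : ℝ) (g : SmoothMetric m M) (h : SmoothMetric n N) (ψ : M → N) : ℝ :=
  ∫ x, (1 + normSqDiff g h ψ x) ^ α ∂(volumeMeasure g)

/-- Harmonic maps of a compact manifold: the critical points of the energy. -/
def IsHarmonic [MeasurableSpace M] [T2Space M] [SigmaCompactSpace M]
    (g : SmoothMetric m M) (h : SmoothMetric n N) (ψ : M → N) : Prop :=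
  IsCritical m n (energy g h) ψ

/-- `α`-harmonic maps of a compact manifold: the critical points of the `α`-energy. -/
def IsAlphaHarmonic [MeasurableSpace M] [T2Space M] [SigmaCompactSpace M]
    (α : ℝ) (g : SmoothMetric m M) (h : SmoothMetric n N) (ψ : M → N) : Prop :=
  IsCritical m n (alphaEnergy α g h) ψ

/-- The partial derivative `∂_i f (y)`. -/
def partialDeriv (f : EuclideanSpace ℝ (Fin m) → ℝ) (i : Fin m)
    (y : EuclideanSpace ℝ (Fin m)) : ℝ :=
  fderiv ℝ f y (stdVec m i)

/-- The Christoffel symbols `Γ^k_ij` of the Levi-Civita connection in the chart at `p`. -/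
def christoffel (g : SmoothMetric m M) (p : M) (y : EuclideanSpace ℝ (Fin m))
    (k i j : Fin m) : ℝ :=
  (1 / 2) * ∑ l, (chartGram g p y)⁻¹ k l *
    (partialDeriv (fun z => chartGram g p z j l) i y
      + partialDeriv (fun z => chartGram g p z i l) j y
      - partialDeriv (fun z => chartGram g p z i j) l y)

/-- The `c`-th component of `ψ` in the charts at `x` and at `ψ x`. -/
def localRep (ψ : M → N) (x : M) (c : Fin n) (y : EuclideanSpace ℝ (Fin m)) : ℝ :=
  (writtenInExtChartAt (𝓡 m) (𝓡 n) x ψ y : EuclideanSpace ℝ (Fin n)) c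

/-- The second fundamental form `(∇dψ)^c_ij` of `ψ` at `x`, in the charts at `x` and `ψ x`:
`∂_i ∂_j ψ^c - Γ^k_ij ∂_k ψ^c + Γ^c_ab ∂_i ψ^a ∂_j ψ^b`. -/
def secondFundForm (g : SmoothMetric m M) (h : SmoothMetric n N) (ψ : M → N) (x : M)
    (c : Fin n) (i j : Fin m) : ℝ :=
  let y := extChartAt (𝓡 m) x x
  partialDeriv (partialDeriv (localRep ψ x c) j) i y
    - ∑ k, christoffel g x y k i j * partialDeriv (localRep ψ x c) k y
    + ∑ a, ∑ b, christoffel h (ψ x) (extChartAt (𝓡 n) (ψ x) (ψ x)) c a b *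
        partialDeriv (localRep ψ x a) i y * partialDeriv (localRep ψ x b) j y

/-- The tension field `τ(ψ) = tr_g ∇dψ`, a section of `ψ⁻¹TN`. Its value at `x` is given by its
components in the preferred chart at `ψ x`, through which Mathlib identifies `T_{ψ x} N` with
`ℝⁿ`. -/
def tension (g : SmoothMetric m M) (h : SmoothMetric n N) (ψ : M → N) (x : M) :
    TangentSpace (𝓡 n) (ψ x) :=
  (WithLp.toLp 2 fun c : Fin n =>
    ∑ i, ∑ j, (gram g x)⁻¹ i j * secondFundForm g h ψ x c i j : EuclideanSpace ℝ (Fin n))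

/-- The `α`-tension field
`τ_α(ψ) = 2α (1 + |dψ|²)^(α-1) τ(ψ) + dψ (grad (2α (1 + |dψ|²)^(α-1)))`. -/
def alphaTension (α : ℝ) (g : SmoothMetric m M) (h : SmoothMetric n N) (ψ : M → N) (x : M) :
    TangentSpace (𝓡 n) (ψ x) :=
  (2 * α * (1 + normSqDiff g h ψ x) ^ (α - 1)) • tension g h ψ x
    + mfderiv (𝓡 m) (𝓡 n) ψ x
        (grad g (fun z => 2 * α * (1 + normSqDiff g h ψ z) ^ (α - 1)) x)

end Maps

end AlphaHarmonic

end

/-!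
Write `e(φ) = |dφ|²` for the energy density with respect to `g`, and let `f` be the conformal factor
of the theorem, so that `f ^ ((m - 2) / 2) = 2 α (1 + e(ψ)) ^ (α - 1) =: F` and `gbar = f g`.

*Critical points.* A conformal change by `f` divides the energy density by `f`
(`normSqDiff_conformal`) and multiplies the volume measure by `f ^ (m / 2)`
(`volumeMeasure_conformal`), so the energy for `gbar` is `φ ↦ 1/2 ∫ F e(φ) dV_g`
(`energy_conformal`). Here `F` depends on the fixed map `ψ` only, not on `φ`. Along a variation `Ψ`
of `ψ`, the derivative at `0` of this energy is `1/2 ∫ F ∂ₜe(Ψₜ) dV_g`, while that of the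
`α`-energy is `∫ α (1 + e(ψ)) ^ (α - 1) ∂ₜe(Ψₜ) dV_g`. The two integrals agree, so the two
derivatives vanish together (`isAlphaHarmonic_iff_isHarmonic`), and no integration by parts is
needed. Differentiating under the integral sign rests on the joint
smoothness of `e(Ψₜ)(x)` in `t` and `x` (`contDiffOn_normSqDiff`) and on the finiteness of the
volume (`isFiniteMeasure_volumeMeasure`).

*Tension fields.* The trace of the change of the Christoffel symbols under `g ↦ f g` gives
`f τ_gbar(ψ) = τ_g(ψ) + (m - 2) / (2 f) dψ(grad f)` (`tension_conformal`). Multiplying by `F` and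
using `grad F = (m - 2) / (2 f) F grad f` yields `τ_α(ψ) = F f τ_gbar(ψ)`
(`smul_tension_add_mfderiv_grad`), where `F f > 0`.

The frame `tangentVec` does not vary smoothly with the point, because the preferred chart
changes from point to point. Smoothness of `e` is therefore proved in the coordinate frame of one
chart, after a check that `g^{ij} h(dφ eᵢ, dφ eⱼ)` is independent of the frame
(`sum_inv_formMatrix_comp`, `normSqDiff_chart`).
-/

noncomputable section

namespace AlphaHarmonic

/-! ### Contractions with the inverse of a Gram matrix -/

section LinearAlgebra

variable {m : ℕ}

/-- The matrix of a bilinear form in a family of vectors. -/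
def formMatrix {V : Type*} [AddCommGroup V] [Module ℝ V] [TopologicalSpace V]
    (b : V →L[ℝ] V →L[ℝ] ℝ) (v : Fin m → V) : Matrix (Fin m) (Fin m) ℝ :=
  Matrix.of fun i j => b (v i) (v j)

lemma sum_smul_stdVec (x : EuclideanSpace ℝ (Fin m)) : ∑ k, x k • stdVec m k = x := by
  ext i
  simp [stdVec, Pi.single_apply]

/-- The contraction `G^{ij} Q_ij` does not depend on the basis in which it is computed. -/
lemma sum_inv_mul_congr {A G Q : Matrix (Fin m) (Fin m) ℝ} (hA : IsUnit A.det) :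
    ∑ i, ∑ j, (A * G * A.transpose)⁻¹ i j * (A * Q * A.transpose) i j =
      ∑ i, ∑ j, G⁻¹ i j * Q i j := by
  have key : ∀ X Y : Matrix (Fin m) (Fin m) ℝ,
      ∑ i, ∑ j, X i j * Y i j = (X.transpose * Y).trace := by
    intro X Y
    rw [Finset.sum_comm]
    simp [Matrix.trace, Matrix.mul_apply]
  have hAt : IsUnit A.transpose.det := by rwa [Matrix.det_transpose]
  rw [key, key, Matrix.mul_inv_rev, Matrix.mul_inv_rev, Matrix.transpose_mul,
    Matrix.transpose_mul, ← Matrix.transpose_nonsing_inv, Matrix.transpose_transpose]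
  rw [Matrix.transpose_nonsing_inv A]
  have : A.transpose⁻¹ * G⁻¹.transpose * A⁻¹ * (A * Q * A.transpose)
      = A.transpose⁻¹ * (G⁻¹.transpose * Q * A.transpose) := by
    simp only [Matrix.mul_assoc]
    rw [Matrix.nonsing_inv_mul_cancel_left _ _ hA]
  rw [this, Matrix.trace_mul_comm, Matrix.mul_assoc, Matrix.mul_nonsing_inv _ hAt, Matrix.mul_one]

/-- The matrix of a form in a family of vectors is obtained by congruence from its matrix in the
standard basis. -/
lemma formMatrix_eq_mul (b : EuclideanSpace ℝ (Fin m) →L[ℝ] EuclideanSpace ℝ (Fin m) →L[ℝ] ℝ)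
    (v : Fin m → EuclideanSpace ℝ (Fin m)) :
    formMatrix b v = (Matrix.of fun i k => v i k) * formMatrix b (stdVec m) *
      (Matrix.of fun i k => v i k).transpose := by
  ext i j
  conv_lhs => rw [formMatrix, Matrix.of_apply, ← sum_smul_stdVec (v i), ← sum_smul_stdVec (v j)]
  simp only [map_sum, map_smul, sum_apply, smul_apply,
    Matrix.mul_apply, Matrix.of_apply, Matrix.transpose_apply, formMatrix, smul_eq_mul,
    Finset.sum_mul, Finset.mul_sum]
  refine Finset.sum_congr rfl fun k _ => Finset.sum_congr rfl fun l _ => by ring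

lemma det_coords_isUnit (T : EuclideanSpace ℝ (Fin m) →L[ℝ] EuclideanSpace ℝ (Fin m))
    (hT : T.IsInvertible) :
    IsUnit (Matrix.of fun i k => T (stdVec m i) k : Matrix (Fin m) (Fin m) ℝ).det := by
  obtain ⟨S, rfl⟩ := hT
  refine (Matrix.isUnit_iff_isUnit_det _).1 ?_
  refine IsUnit.of_mul_eq_one
    (Matrix.of fun i k => S.symm (stdVec m i) k : Matrix (Fin m) (Fin m) ℝ) ?_
  ext i j
  have h1 : S.symm (S (stdVec m i)) j = stdVec m i j := by simp
  rw [← sum_smul_stdVec (S (stdVec m i))] at h1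
  simp only [map_sum, map_smul] at h1
  simp only [WithLp.ofLp_sum, Finset.sum_apply, PiLp.smul_apply, smul_eq_mul] at h1
  simp only [Matrix.mul_apply, Matrix.of_apply, Matrix.one_apply]
  refine h1.trans ?_
  simp [stdVec, PiLp.single_apply, eq_comm]

/-- The trace of `q` with respect to `b` may be computed in the image of the standard basis under
any invertible map. -/
lemma sum_inv_formMatrix_comp
    (b q : EuclideanSpace ℝ (Fin m) →L[ℝ] EuclideanSpace ℝ (Fin m) →L[ℝ] ℝ)
    (T : EuclideanSpace ℝ (Fin m) →L[ℝ] EuclideanSpace ℝ (Fin m)) (hT : T.IsInvertible) :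
    ∑ i, ∑ j, (formMatrix b fun i => T (stdVec m i))⁻¹ i j *
        q (T (stdVec m i)) (T (stdVec m j)) =
      ∑ i, ∑ j, (formMatrix b (stdVec m))⁻¹ i j * q (stdVec m i) (stdVec m j) := by
  have := sum_inv_mul_congr (G := formMatrix b (stdVec m)) (Q := formMatrix q (stdVec m))
    (det_coords_isUnit T hT)
  rw [← formMatrix_eq_mul b (fun i => T (stdVec m i)),
    ← formMatrix_eq_mul q (fun i => T (stdVec m i))] at this
  exact this

lemma dotProduct_formMatrix_mulVec
    (b : EuclideanSpace ℝ (Fin m) →L[ℝ] EuclideanSpace ℝ (Fin m) →L[ℝ] ℝ) (x : Fin m → ℝ) :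
    dotProduct (star x) ((formMatrix b (stdVec m)).mulVec x) =
      b (WithLp.toLp 2 x) (WithLp.toLp 2 x) := by
  conv_rhs => rw [← sum_smul_stdVec (WithLp.toLp 2 x)]
  simp only [map_sum, map_smul, sum_apply, smul_apply, smul_eq_mul, dotProduct, Matrix.mulVec,
    formMatrix, Matrix.of_apply, Finset.mul_sum, star_trivial]
  rw [Finset.sum_comm]
  refine Finset.sum_congr rfl fun k _ => Finset.sum_congr rfl fun l _ => by ring

lemma formMatrix_isHermitian
    (b : EuclideanSpace ℝ (Fin m) →L[ℝ] EuclideanSpace ℝ (Fin m) →L[ℝ] ℝ)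
    (hs : ∀ v w, b v w = b w v) : (formMatrix b (stdVec m)).IsHermitian := by
  ext i j
  simp [formMatrix, hs (stdVec m i)]

lemma formMatrix_posDef (b : EuclideanSpace ℝ (Fin m) →L[ℝ] EuclideanSpace ℝ (Fin m) →L[ℝ] ℝ)
    (hs : ∀ v w, b v w = b w v) (hp : ∀ v, v ≠ 0 → 0 < b v v) :
    (formMatrix b (stdVec m)).PosDef := by
  refine .of_dotProduct_mulVec_pos (formMatrix_isHermitian b hs) fun x hx => ?_
  rw [dotProduct_formMatrix_mulVec]
  exact hp _ (by simpa using hx)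

lemma formMatrix_posSemidef
    (b : EuclideanSpace ℝ (Fin m) →L[ℝ] EuclideanSpace ℝ (Fin m) →L[ℝ] ℝ)
    (hs : ∀ v w, b v w = b w v) (hp : ∀ v, 0 ≤ b v v) :
    (formMatrix b (stdVec m)).PosSemidef := by
  refine .of_dotProduct_mulVec_nonneg (formMatrix_isHermitian b hs) fun x => ?_
  rw [dotProduct_formMatrix_mulVec]
  exact hp _

/-- Writing `G⁻¹ = Cᵀ C`, the contraction is the sum of the values of `Q` at the rows of `C`. -/
lemma sum_inv_mul_nonneg {G Q : Matrix (Fin m) (Fin m) ℝ} (hG : G.PosDef) (hQ : Q.PosSemidef) :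
    0 ≤ ∑ i, ∑ j, G⁻¹ i j * Q i j := by
  obtain ⟨C, hC⟩ : ∃ C : Matrix (Fin m) (Fin m) ℝ, G⁻¹ = C.conjTranspose * C := by
    open scoped MatrixOrder in
    exact CStarAlgebra.nonneg_iff_eq_star_mul_self.1 hG.inv.posSemidef.nonneg
  have h : ∑ i, ∑ j, G⁻¹ i j * Q i j = ∑ k, dotProduct (C k) (Q.mulVec (C k)) := by
    have h1 : ∀ i j, G⁻¹ i j * Q i j = ∑ k, C k i * (Q i j * C k j) := fun i j => by
      rw [hC, Matrix.mul_apply, Finset.sum_mul]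
      exact Finset.sum_congr rfl fun k _ => by
        rw [Matrix.conjTranspose_apply, star_trivial]; ring
    simp only [h1, dotProduct, Matrix.mulVec, Finset.mul_sum]
    rw [Finset.sum_comm (s := Finset.univ (α := Fin m)) (f := fun k i => ∑ j, C k i * _)]
    exact Finset.sum_congr rfl fun i _ => Finset.sum_comm
  rw [h]
  exact Finset.sum_nonneg fun k _ => by simpa using hQ.dotProduct_mulVec_nonneg (C k)

end LinearAlgebra

/-! ### Smoothness of pulled back metrics -/

section Smoothness

variable {n : ℕ} {N : Type*} [TopologicalSpace N] [ChartedSpace (EuclideanSpace ℝ (Fin n)) N]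
  [IsManifold (𝓡 n) ∞ N]

/-- The entries of the metric pulled back by a smooth map from a normed space are smooth. This
applies both to inverse charts, giving the coefficients of a metric, and to families of maps. -/
lemma contDiffOn_inner_mfderiv (h : SmoothMetric n N) {F : Type*} [NormedAddCommGroup F]
    [NormedSpace ℝ F] {U : Set F} (hU : IsOpen U) {Φ : F → N}
    (hΦ : ContMDiffOn 𝓘(ℝ, F) (𝓡 n) ∞ Φ U) (v w : F) :
    ContDiffOn ℝ ∞ (fun z => h.inner (Φ z) (mfderiv 𝓘(ℝ, F) (𝓡 n) Φ z v)
      (mfderiv 𝓘(ℝ, F) (𝓡 n) Φ z w)) U := by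
  have hsec : ∀ v : F, ContMDiffOn 𝓘(ℝ, F) ((𝓡 n).prod 𝓘(ℝ, EuclideanSpace ℝ (Fin n))) ∞
      (fun z => TotalSpace.mk' (EuclideanSpace ℝ (Fin n)) (E := fun x : N => TangentSpace (𝓡 n) x)
        (Φ z) (mfderiv 𝓘(ℝ, F) (𝓡 n) Φ z v)) U := by
    intro v
    have h1 := hΦ.contMDiffOn_tangentMapWithin (m := ∞) (by simp) hU.uniqueMDiffOn
    have h2 : ContMDiffOn 𝓘(ℝ, F) 𝓘(ℝ, F).tangent ∞
        (fun z : F => (⟨z, v⟩ : TangentBundle 𝓘(ℝ, F) F)) U :=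
      contMDiffOn_vectorSpace_iff_contDiffOn.2 contDiffOn_const
    refine (h1.comp h2 fun z hz => hz).congr fun z hz => ?_
    simp only [Function.comp, tangentMapWithin]
    rw [mfderivWithin_of_isOpen hU hz]
  have hh := h.contMDiff.comp_contMDiffOn hΦ
  have := ContMDiffOn.clm_bundle_apply₂ (F₁ := EuclideanSpace ℝ (Fin n))
    (F₂ := EuclideanSpace ℝ (Fin n)) (F₃ := ℝ)
    (E₁ := fun x : N => TangentSpace (𝓡 n) x) (E₂ := fun x : N => TangentSpace (𝓡 n) x)
    (E₃ := fun x : N => Trivial N ℝ x) hh (hsec v) (hsec w)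
  -- The values lie in the trivial line bundle over `N`, so smoothness is that of the fibre part.
  intro z hz
  have h3 := (contMDiffWithinAt_totalSpace.1 (this z hz)).2
  exact h3.contDiffWithinAt

end Smoothness

/-! ### The energy density in charts -/

section Charts

variable {m n : ℕ}
  {M : Type*} [TopologicalSpace M] [ChartedSpace (EuclideanSpace ℝ (Fin m)) M]
  [IsManifold (𝓡 m) ∞ M]
  {N : Type*} [TopologicalSpace N] [ChartedSpace (EuclideanSpace ℝ (Fin n)) N]
  [IsManifold (𝓡 n) ∞ N]

lemma isInvertible_mfderiv_extChartAt_symm {p : M} {y : EuclideanSpace ℝ (Fin m)}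
    (hy : y ∈ (extChartAt (𝓡 m) p).target) :
    (mfderiv (𝓡 m) (𝓡 m) (extChartAt (𝓡 m) p).symm y).IsInvertible := by
  have : IsManifold (𝓡 m) 1 M := IsManifold.of_le (n := ∞) (by simp)
  have h := isInvertible_mfderivWithin_extChartAt_symm (I := 𝓡 m) hy
  rwa [modelWithCornersSelf_coe, Set.range_id, mfderivWithin_univ] at h

lemma mfderiv_extChartAt_symm_self (x : M) (v : EuclideanSpace ℝ (Fin m)) :
    mfderiv (𝓡 m) (𝓡 m) (extChartAt (𝓡 m) x).symm (extChartAt (𝓡 m) x x) v = v := by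
  have : IsManifold (𝓡 m) 1 M := IsManifold.of_le (n := ∞) (by simp)
  have h := mfderivWithin_range_extChartAt_symm (I := 𝓡 m) (x := x)
  rw [modelWithCornersSelf_coe, Set.range_id, mfderivWithin_univ] at h
  rw [h]
  rfl

/-- At its own base point, the coordinate frame of the preferred chart is `tangentVec`. -/
lemma chartGram_self (g : SmoothMetric m M) (x : M) :
    chartGram g x (extChartAt (𝓡 m) x x) = gram g x := by
  have key : ∀ (z : M) (hz : z = x) (v w : EuclideanSpace ℝ (Fin m)),
      g.inner z v w = g.inner x v w := by rintro z rfl v w; rfl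
  ext i j
  simp only [chartGram, gram, Matrix.of_apply, coordVec]
  exact (congrArg₂ (fun v w => g.inner _ v w) (mfderiv_extChartAt_symm_self x _)
    (mfderiv_extChartAt_symm_self x _)).trans (key _ (extChartAt_to_inv x) _ _)

lemma gram_posDef (g : SmoothMetric m M) (x : M) : (gram g x).PosDef :=
  formMatrix_posDef (g.inner x) (g.symm x) (g.pos x)

lemma chartGram_posDef (g : SmoothMetric m M) {p : M} {y : EuclideanSpace ℝ (Fin m)}
    (hy : y ∈ (extChartAt (𝓡 m) p).target) : (chartGram g p y).PosDef := by
  have hA := det_coords_isUnit _ (isInvertible_mfderiv_extChartAt_symm hy)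
  have h := (Matrix.IsUnit.posDef_star_left_conjugate_iff
    (x := gram g ((extChartAt (𝓡 m) p).symm y))
    (U := (Matrix.of fun i k => (show EuclideanSpace ℝ (Fin m) from
      mfderiv (𝓡 m) (𝓡 m) (extChartAt (𝓡 m) p).symm y (stdVec m i)) k).conjTranspose) ?_).2
    (gram_posDef g _)
  · rw [Matrix.star_eq_conjTranspose, Matrix.conjTranspose_conjTranspose] at h
    convert h using 1
    exact formMatrix_eq_mul _ _
  · rw [Matrix.isUnit_iff_isUnit_det, Matrix.det_conjTranspose]
    exact hA.star

lemma contDiffOn_chartGram (g : SmoothMetric m M) (p : M) (i j : Fin m) :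
    ContDiffOn ℝ ∞ (fun y => chartGram g p y i j) (extChartAt (𝓡 m) p).target :=
  contDiffOn_inner_mfderiv g (isOpen_extChartAt_target p) (contMDiffOn_extChartAt_symm p) _ _

lemma contDiffOn_det {F : Type*} [NormedAddCommGroup F] [NormedSpace ℝ F] {U : Set F}
    {A : F → Matrix (Fin m) (Fin m) ℝ} (hA : ∀ i j, ContDiffOn ℝ ∞ (fun z => A z i j) U) :
    ContDiffOn ℝ ∞ (fun z => (A z).det) U := by
  simp only [Matrix.det_apply]
  exact ContDiffOn.sum fun σ _ => (contDiffOn_prod fun i _ => hA _ _).const_smul _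

lemma contDiffOn_inv_apply {F : Type*} [NormedAddCommGroup F] [NormedSpace ℝ F] {U : Set F}
    {A : F → Matrix (Fin m) (Fin m) ℝ} (hA : ∀ i j, ContDiffOn ℝ ∞ (fun z => A z i j) U)
    (h0 : ∀ z ∈ U, (A z).det ≠ 0) (i j : Fin m) :
    ContDiffOn ℝ ∞ (fun z => (A z)⁻¹ i j) U := by
  simp only [Matrix.inv_def, Ring.inverse_eq_inv', Matrix.smul_apply, smul_eq_mul,
    Matrix.adjugate_apply]
  refine ((contDiffOn_det hA).inv h0).mul (contDiffOn_det fun k l => ?_)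
  by_cases hk : k = j
  · subst hk
    simpa using contDiffOn_const
  · simpa [Matrix.updateRow_ne hk] using hA k l

lemma contDiffOn_chartGram_inv (g : SmoothMetric m M) (p : M) (i j : Fin m) :
    ContDiffOn ℝ ∞ (fun y => (chartGram g p y)⁻¹ i j) (extChartAt (𝓡 m) p).target :=
  contDiffOn_inv_apply (contDiffOn_chartGram g p)
    (fun _ hy => (chartGram_posDef g hy).det_pos.ne') i j

/-- `|dφ|²` may be computed in the coordinate frame of any chart. -/
lemma normSqDiff_chart (g : SmoothMetric m M) (h : SmoothMetric n N) {φ : M → N} {p : M}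
    {y : EuclideanSpace ℝ (Fin m)} (hy : y ∈ (extChartAt (𝓡 m) p).target)
    (hφ : MDifferentiableAt (𝓡 m) (𝓡 n) φ ((extChartAt (𝓡 m) p).symm y)) :
    normSqDiff g h φ ((extChartAt (𝓡 m) p).symm y) =
      ∑ i, ∑ j, (chartGram g p y)⁻¹ i j *
        h.inner (φ ((extChartAt (𝓡 m) p).symm y))
          (mfderiv (𝓡 m) (𝓡 n) (φ ∘ (extChartAt (𝓡 m) p).symm) y (stdVec m i))
          (mfderiv (𝓡 m) (𝓡 n) (φ ∘ (extChartAt (𝓡 m) p).symm) y (stdVec m j)) := by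
  have hs : MDifferentiableAt (𝓡 m) (𝓡 m) (extChartAt (𝓡 m) p).symm y :=
    ((contMDiffOn_extChartAt_symm (n := ∞) p).contMDiffAt
      ((isOpen_extChartAt_target p).mem_nhds hy)).mdifferentiableAt (by simp)
  set x := (extChartAt (𝓡 m) p).symm y
  let D : EuclideanSpace ℝ (Fin m) →L[ℝ] EuclideanSpace ℝ (Fin n) := mfderiv (𝓡 m) (𝓡 n) φ x
  let H : EuclideanSpace ℝ (Fin n) →L[ℝ] EuclideanSpace ℝ (Fin n) →L[ℝ] ℝ := h.inner (φ x)
  have := sum_inv_formMatrix_comp (g.inner x) (H.bilinearComp D D) _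
    (isInvertible_mfderiv_extChartAt_symm hy)
  rw [mfderiv_comp y (by exact hφ) hs]
  exact this.symm

lemma normSqDiff_nonneg (g : SmoothMetric m M) (h : SmoothMetric n N) (φ : M → N) (x : M) :
    0 ≤ normSqDiff g h φ x := by
  let D : EuclideanSpace ℝ (Fin m) →L[ℝ] EuclideanSpace ℝ (Fin n) := mfderiv (𝓡 m) (𝓡 n) φ x
  let H : EuclideanSpace ℝ (Fin n) →L[ℝ] EuclideanSpace ℝ (Fin n) →L[ℝ] ℝ := h.inner (φ x)
  refine sum_inv_mul_nonneg (gram_posDef g x) (formMatrix_posSemidef (H.bilinearComp D D)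
    (fun v w => h.symm (φ x) (D v) (D w)) fun v => ?_)
  change 0 ≤ H (D v) (D v)
  by_cases hv : D v = 0
  · simp [hv]
  · exact (h.pos (φ x) (D v) hv).le

/-- The energy density of a smooth family of maps depends smoothly on the parameter and the
point, in every chart. -/
lemma contDiffOn_normSqDiff (g : SmoothMetric m M) (h : SmoothMetric n N) {J : Set ℝ}
    (hJ : IsOpen J) {Ψ : ℝ × M → N}
    (hΨ : ContMDiffOn (𝓘(ℝ, ℝ).prod (𝓡 m)) (𝓡 n) ∞ Ψ (J ×ˢ Set.univ)) (p : M) :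
    ContDiffOn ℝ ∞ (fun z : ℝ × EuclideanSpace ℝ (Fin m) =>
      normSqDiff g h (fun x => Ψ (z.1, x)) ((extChartAt (𝓡 m) p).symm z.2))
      (J ×ˢ (extChartAt (𝓡 m) p).target) := by
  set U := J ×ˢ (extChartAt (𝓡 m) p).target
  have hU : IsOpen U := hJ.prod (isOpen_extChartAt_target p)
  let Φ : ℝ × EuclideanSpace ℝ (Fin m) → N := fun z => Ψ (z.1, (extChartAt (𝓡 m) p).symm z.2)
  have hΦ : ContMDiffOn 𝓘(ℝ, ℝ × EuclideanSpace ℝ (Fin m)) (𝓡 n) ∞ Φ U := by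
    refine hΨ.comp (ContMDiffOn.prodMk contDiff_fst.contMDiff.contMDiffOn
      ((contMDiffOn_extChartAt_symm p).comp contDiff_snd.contMDiff.contMDiffOn fun z hz => hz.2))
      fun z hz => ⟨hz.1, trivial⟩
  have key : ContDiffOn ℝ ∞ (fun z : ℝ × EuclideanSpace ℝ (Fin m) =>
      ∑ i, ∑ j, (chartGram g p z.2)⁻¹ i j *
        h.inner (Φ z) (mfderiv 𝓘(ℝ, ℝ × EuclideanSpace ℝ (Fin m)) (𝓡 n) Φ z (0, stdVec m i))
          (mfderiv 𝓘(ℝ, ℝ × EuclideanSpace ℝ (Fin m)) (𝓡 n) Φ z (0, stdVec m j))) U :=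
    ContDiffOn.sum fun i _ => ContDiffOn.sum fun j _ =>
      ((contDiffOn_chartGram_inv g p i j).comp contDiffOn_snd fun z hz => hz.2).mul
        (contDiffOn_inner_mfderiv h hU hΦ _ _)
  refine key.congr fun z hz => ?_
  obtain ⟨t, y⟩ := z
  have hslice : ContMDiff (𝓡 m) (𝓘(ℝ, ℝ).prod (𝓡 m)) ∞ (fun x : M => (t, x)) :=
    contMDiff_const.prodMk contMDiff_id
  have hφ : MDifferentiableAt (𝓡 m) (𝓡 n) (fun x => Ψ (t, x)) ((extChartAt (𝓡 m) p).symm y) := by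
    refine ContMDiffAt.mdifferentiableAt (n := ∞) ?_ (by simp)
    exact (hΨ.contMDiffAt ((hJ.prod isOpen_univ).mem_nhds ⟨hz.1, trivial⟩)).comp
      ((extChartAt (𝓡 m) p).symm y) hslice.contMDiffAt
  simp only
  rw [normSqDiff_chart g h hz.2 hφ]
  have hd : ∀ v, mfderiv (𝓡 m) (𝓡 n) ((fun x => Ψ (t, x)) ∘ (extChartAt (𝓡 m) p).symm) y v =
      mfderiv 𝓘(ℝ, ℝ × EuclideanSpace ℝ (Fin m)) (𝓡 n) Φ (t, y) (0, v) := by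
    intro v
    have hc : HasFDerivAt (fun y' : EuclideanSpace ℝ (Fin m) => (t, y'))
        (ContinuousLinearMap.inr ℝ ℝ (EuclideanSpace ℝ (Fin m))) y :=
      hasFDerivAt_prodMk_right t y
    have hm : MDifferentiableAt 𝓘(ℝ, ℝ × EuclideanSpace ℝ (Fin m)) (𝓡 n) Φ (t, y) :=
      (hΦ.contMDiffAt (hU.mem_nhds hz)).mdifferentiableAt (by simp)
    have := (hm.hasMFDerivAt.comp y hc.hasMFDerivAt).mfderiv
    change mfderiv (𝓡 m) (𝓡 n) (Φ ∘ fun y' => (t, y')) y v = _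
    rw [this]
    rfl
  exact Finset.sum_congr rfl fun i _ => Finset.sum_congr rfl fun j _ => congrArg (_ * ·)
    (congrArg₂ (fun v w : EuclideanSpace ℝ (Fin n) => h.inner (Φ (t, y)) v w) (hd _) (hd _))

end Charts

/-! ### Conformal change of the metric -/

section Conformal

open scoped Pointwise

variable {m n : ℕ}
  {M : Type*} [TopologicalSpace M] [ChartedSpace (EuclideanSpace ℝ (Fin m)) M]
  [IsManifold (𝓡 m) ∞ M]
  {N : Type*} [TopologicalSpace N] [ChartedSpace (EuclideanSpace ℝ (Fin n)) N]
  [IsManifold (𝓡 n) ∞ N]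

lemma contMDiff_normSqDiff (g : SmoothMetric m M) (h : SmoothMetric n N) {ψ : M → N}
    (hψ : ContMDiff (𝓡 m) (𝓡 n) ∞ ψ) : ContMDiff (𝓡 m) 𝓘(ℝ, ℝ) ∞ (normSqDiff g h ψ) := by
  intro x
  -- A single map is regarded as a family that is constant in the parameter.
  have hΨ : ContMDiffOn (𝓘(ℝ, ℝ).prod (𝓡 m)) (𝓡 n) ∞ (fun z : ℝ × M => ψ z.2)
      (Set.univ ×ˢ Set.univ) := (hψ.comp contMDiff_snd).contMDiffOn
  have h1 := (contDiffOn_normSqDiff g h isOpen_univ hΨ x).contDiffAt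
    (x := ((0 : ℝ), extChartAt (𝓡 m) x x))
    ((isOpen_univ.prod (isOpen_extChartAt_target x)).mem_nhds
      ⟨trivial, mem_extChartAt_target x⟩)
  have h2 : ContDiffAt ℝ ∞ (fun y : EuclideanSpace ℝ (Fin m) => ((0 : ℝ), y))
      (extChartAt (𝓡 m) x x) := contDiffAt_const.prodMk contDiffAt_id
  have h3 := ContDiffAt.comp (extChartAt (𝓡 m) x x) h1 h2
  refine (h3.contMDiffAt.comp x contMDiffAt_extChartAt).congr_of_eventuallyEq ?_
  filter_upwards [extChartAt_source_mem_nhds (I := 𝓡 m) x] with z hz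
  simp only [Function.comp]
  rw [(extChartAt (𝓡 m) x).left_inv hz]

/-- The metric `f g` conformal to `g`, for a smooth positive function `f`. -/
def conformalMetric (g : SmoothMetric m M) (f : M → ℝ) (hf : ContMDiff (𝓡 m) 𝓘(ℝ, ℝ) ∞ f)
    (hpos : ∀ x, 0 < f x) : SmoothMetric m M where
  inner x := f x • g.inner x
  symm x v w := by
    change f x * g.inner x v w = f x * g.inner x w v
    rw [g.symm]
  pos x v hv := mul_pos (hpos x) (g.pos x v hv)
  isVonNBounded x := by
    -- The unit ball of `f g` is the unit ball of `g` scaled by `1 / √f`.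
    have h1 : {v : TangentSpace (𝓡 m) x | (f x • g.inner x) v v < 1} =
        (Real.sqrt (f x))⁻¹ • {v : TangentSpace (𝓡 m) x | g.inner x v v < 1} := by
      have h0 : Real.sqrt (f x) ≠ 0 := (Real.sqrt_pos.2 (hpos x)).ne'
      ext v
      rw [Set.mem_inv_smul_set_iff₀ h0]
      change f x * g.inner x v v < 1 ↔ g.inner x (Real.sqrt (f x) • v) (Real.sqrt (f x) • v) < 1
      rw [map_smul, map_smul, smul_apply, smul_eq_mul, smul_eq_mul,
        ← mul_assoc, Real.mul_self_sqrt (hpos x).le]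
    rw [h1]
    exact (g.isVonNBounded x).image
      ((Real.sqrt (f x))⁻¹ • ContinuousLinearMap.id ℝ (TangentSpace (𝓡 m) x))
  contMDiff := by
    have : ∀ x : M, IsTopologicalAddGroup (TangentSpace (𝓡 m) x →L[ℝ] ℝ) := fun x => inferInstance
    have : ∀ x : M, ContinuousSMul ℝ (TangentSpace (𝓡 m) x →L[ℝ] ℝ) := fun x => inferInstance
    exact ContMDiff.smul_section (V := fun x : M =>
      TangentSpace (𝓡 m) x →L[ℝ] (TangentSpace (𝓡 m) x →L[ℝ] ℝ)) hf g.contMDiff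

variable {g g' : SmoothMetric m M} {f : M → ℝ}

lemma gram_conformal (hg : ∀ x (v w : TangentSpace (𝓡 m) x), g'.inner x v w = f x * g.inner x v w)
    (x : M) : gram g' x = f x • gram g x := by
  ext i j
  exact hg x _ _

lemma chartGram_conformal
    (hg : ∀ x (v w : TangentSpace (𝓡 m) x), g'.inner x v w = f x * g.inner x v w)
    (p : M) (y : EuclideanSpace ℝ (Fin m)) :
    chartGram g' p y = f ((extChartAt (𝓡 m) p).symm y) • chartGram g p y := by
  ext i j
  exact hg _ _ _

lemma inv_smul_matrix {c : ℝ} (hc : c ≠ 0) {A : Matrix (Fin m) (Fin m) ℝ} (hA : A.det ≠ 0) :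
    (c • A)⁻¹ = c⁻¹ • A⁻¹ := by
  have := invertibleOfNonzero hc
  rw [Matrix.inv_smul A c (isUnit_iff_ne_zero.2 hA), invOf_eq_inv]

lemma normSqDiff_conformal
    (hg : ∀ x (v w : TangentSpace (𝓡 m) x), g'.inner x v w = f x * g.inner x v w)
    (hf : ∀ x, 0 < f x) (h : SmoothMetric n N) (φ : M → N) (x : M) :
    normSqDiff g' h φ x = (f x)⁻¹ * normSqDiff g h φ x := by
  simp only [normSqDiff, gram_conformal hg,
    inv_smul_matrix (hf x).ne' (gram_posDef g x).det_pos.ne', Finset.mul_sum, Matrix.smul_apply,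
    smul_eq_mul, mul_assoc]

end Conformal

/-! ### The volume measure under a conformal change -/

section Volume

lemma aemeasurable_extChartAt_symm {m : ℕ} {M : Type*} [TopologicalSpace M]
    [ChartedSpace (EuclideanSpace ℝ (Fin m)) M] [MeasurableSpace M] [BorelSpace M] (p : M) :
    AEMeasurable (extChartAt (𝓡 m) p).symm (volume.restrict (extChartAt (𝓡 m) p).target) :=
  (continuousOn_extChartAt_symm p).aemeasurable (isOpen_extChartAt_target p).measurableSet

variable {m : ℕ}
  {M : Type*} [TopologicalSpace M] [ChartedSpace (EuclideanSpace ℝ (Fin m)) M]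
  [IsManifold (𝓡 m) ∞ M]

lemma map_withDensity_comp {X Y : Type*} [MeasurableSpace X] [MeasurableSpace Y] {μ : Measure X}
    {s : X → Y} (hs : AEMeasurable s μ) {L : Y → ENNReal} (hL : Measurable L) :
    (μ.withDensity (L ∘ s)).map s = (μ.map s).withDensity L := by
  ext A hA
  have hs' : AEMeasurable s (μ.withDensity (L ∘ s)) :=
    hs.mono_ac (withDensity_absolutelyContinuous _ _)
  rw [Measure.map_apply_of_aemeasurable hs' hA, withDensity_apply _ hA,
    withDensity_apply₀ _ (hs.nullMeasurable hA), Measure.restrict_map_of_aemeasurable hs hA,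
    lintegral_map' hL.aemeasurable hs.restrict]
  rfl

lemma continuousOn_sqrt_det_chartGram (g : SmoothMetric m M) (p : M) :
    ContinuousOn (fun y => Real.sqrt (chartGram g p y).det) (extChartAt (𝓡 m) p).target :=
  (contDiffOn_det (contDiffOn_chartGram g p)).continuousOn.sqrt

lemma aemeasurable_density (g : SmoothMetric m M) (p : M) :
    AEMeasurable (fun y => ENNReal.ofReal (Real.sqrt (chartGram g p y).det))
      (volume.restrict (extChartAt (𝓡 m) p).target) :=
  ((continuousOn_sqrt_det_chartGram g p).aemeasurable
    (isOpen_extChartAt_target p).measurableSet).ennreal_ofReal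

variable [MeasurableSpace M] [BorelSpace M]

lemma chartVolume_conformal {g g' : SmoothMetric m M} {f : M → ℝ}
    (hg : ∀ x (v w : TangentSpace (𝓡 m) x), g'.inner x v w = f x * g.inner x v w)
    (hf : ∀ x, 0 < f x) (hfc : Continuous f) (p : M) :
    chartVolume g' p =
      (chartVolume g p).withDensity fun x => ENNReal.ofReal (f x ^ ((m : ℝ) / 2)) := by
  have hLm : Measurable fun x => ENNReal.ofReal (f x ^ ((m : ℝ) / 2)) :=
    (hfc.rpow_const fun x => Or.inl (hf x).ne').measurable.ennreal_ofReal
  unfold chartVolume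
  rw [← map_withDensity_comp ((aemeasurable_extChartAt_symm p).mono_ac
    (withDensity_absolutelyContinuous _ _)) hLm]
  rw [← withDensity_mul₀ (aemeasurable_density g p)
    (hLm.comp_aemeasurable (aemeasurable_extChartAt_symm p))]
  congr 1
  refine withDensity_congr_ae (Filter.Eventually.of_forall fun y => ?_)
  simp only [chartGram_conformal hg, Matrix.det_smul, Fintype.card_fin, Pi.mul_apply,
    Function.comp]
  have h0 := hf ((extChartAt (𝓡 m) p).symm y)
  rw [Real.sqrt_mul (pow_nonneg h0.le _), mul_comm, ENNReal.ofReal_mul (Real.sqrt_nonneg _),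
    Real.sqrt_eq_rpow (_ ^ m), ← Real.rpow_natCast, ← Real.rpow_mul h0.le, mul_one_div]

variable [T2Space M] [SigmaCompactSpace M]

lemma measurable_chartPartition (p : M) :
    Measurable fun x => ENNReal.ofReal (chartPartition m M p x) :=
  (chartPartition m M p).contMDiff.continuous.measurable.ennreal_ofReal

/-- A conformal change of the metric by `f` multiplies the volume measure by `f ^ (m / 2)`. -/
lemma volumeMeasure_conformal {g g' : SmoothMetric m M} {f : M → ℝ}
    (hg : ∀ x (v w : TangentSpace (𝓡 m) x), g'.inner x v w = f x * g.inner x v w)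
    (hf : ∀ x, 0 < f x) (hfc : Continuous f) :
    volumeMeasure g' =
      (volumeMeasure g).withDensity fun x => ENNReal.ofReal (f x ^ ((m : ℝ) / 2)) := by
  have hLm : Measurable fun x => ENNReal.ofReal (f x ^ ((m : ℝ) / 2)) :=
    (hfc.rpow_const fun x => Or.inl (hf x).ne').measurable.ennreal_ofReal
  unfold volumeMeasure
  rw [withDensity_sum]
  congr 1
  funext p
  rw [chartVolume_conformal hg hf hfc, ← withDensity_mul _ hLm (measurable_chartPartition p),
    ← withDensity_mul _ (measurable_chartPartition p) hLm, mul_comm]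

/-- The function of the partition of unity has compact support in the domain of the chart, where
the density of the volume is continuous. -/
lemma withDensity_chartVolume_lt_top [CompactSpace M] (g : SmoothMetric m M) (p : M) :
    (chartVolume g p).withDensity (fun x => ENNReal.ofReal (chartPartition m M p x)) Set.univ
      < ⊤ := by
  set ρ := chartPartition m M p
  set T := (extChartAt (𝓡 m) p).target
  have hsub : tsupport ρ ⊆ (chartAt (EuclideanSpace ℝ (Fin m)) p).source :=
    (SmoothPartitionOfUnity.exists_isSubordinate_chartAt_source (𝓡 m) M).choose_spec p
  have hsub' : tsupport ρ ⊆ (extChartAt (𝓡 m) p).source := by rwa [extChartAt_source]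
  -- The image of the support in the chart, outside of which the integrand vanishes.
  set K := extChartAt (𝓡 m) p '' tsupport ρ
  have hK : IsCompact K := (isClosed_tsupport ρ).isCompact.image_of_continuousOn
    ((continuousOn_extChartAt p).mono hsub')
  have hKT : K ⊆ T := by
    rintro _ ⟨x, hx, rfl⟩
    exact (extChartAt (𝓡 m) p).map_source (hsub' hx)
  have hcont : ContinuousOn (fun y => Real.sqrt (chartGram g p y).det *
      ρ ((extChartAt (𝓡 m) p).symm y)) K :=
    ((continuousOn_sqrt_det_chartGram g p).mono hKT).mul
      (ρ.contMDiff.continuous.comp_continuousOn ((continuousOn_extChartAt_symm p).mono hKT))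
  obtain ⟨C, hC⟩ := hK.exists_bound_of_continuousOn hcont
  have hs := aemeasurable_extChartAt_symm (m := m) p
  have hρ : AEMeasurable (fun y => ENNReal.ofReal (ρ ((extChartAt (𝓡 m) p).symm y)))
      (volume.restrict T) := (measurable_chartPartition p).comp_aemeasurable hs
  rw [withDensity_apply _ MeasurableSet.univ, Measure.restrict_univ, chartVolume,
    lintegral_map' (measurable_chartPartition p).aemeasurable
      (hs.mono_ac (withDensity_absolutelyContinuous _ _)),
    lintegral_withDensity_eq_lintegral_mul₀ (aemeasurable_density g p) hρ]
  have hle : ∀ y ∈ T, ((fun y => ENNReal.ofReal (Real.sqrt (chartGram g p y).det)) *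
      fun y => ENNReal.ofReal (ρ ((extChartAt (𝓡 m) p).symm y))) y ≤
        K.indicator (fun _ => ENNReal.ofReal C) y := by
    intro y hy
    by_cases hyK : y ∈ K
    · rw [Set.indicator_of_mem hyK, Pi.mul_apply, ← ENNReal.ofReal_mul (Real.sqrt_nonneg _)]
      exact ENNReal.ofReal_le_ofReal ((le_abs_self _).trans (hC y hyK))
    · have h0 : ρ ((extChartAt (𝓡 m) p).symm y) = 0 := by
        by_contra hne
        exact hyK ⟨_, subset_tsupport _ hne, (extChartAt (𝓡 m) p).right_inv hy⟩
      rw [Pi.mul_apply, h0]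
      simp
  calc _ ≤ ∫⁻ y in T, K.indicator (fun _ => ENNReal.ofReal C) y :=
        setLIntegral_mono' (isOpen_extChartAt_target p).measurableSet hle
    _ ≤ ∫⁻ y, K.indicator (fun _ => ENNReal.ofReal C) y := setLIntegral_le_lintegral _ _
    _ = ENNReal.ofReal C * volume K := lintegral_indicator_const hK.measurableSet _
    _ < ⊤ := ENNReal.mul_lt_top ENNReal.ofReal_lt_top hK.measure_lt_top

/-- The volume of a compact Riemannian manifold is finite: by compactness only finitely many
functions of the partition of unity do not vanish, and each of them has compact support in its
chart. -/
lemma isFiniteMeasure_volumeMeasure [CompactSpace M] (g : SmoothMetric m M) :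
    IsFiniteMeasure (volumeMeasure g) := by
  have hfin := (chartPartition m M).locallyFinite.finite_nonempty_of_compact
  refine ⟨?_⟩
  rw [volumeMeasure, Measure.sum_apply _ MeasurableSet.univ, tsum_eq_sum (s := hfin.toFinset)]
  · exact ENNReal.sum_lt_top.2 fun p _ => withDensity_chartVolume_lt_top g p
  · intro p hp
    have h0 : ∀ x, chartPartition m M p x = 0 := by
      simpa [Set.not_nonempty_iff_eq_empty, Function.support_eq_empty_iff, funext_iff] using hp
    simp [h0]

end Volume

/-! ### The tension field under a conformal change -/

section Tension

variable {m n : ℕ}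
  {M : Type*} [TopologicalSpace M] [ChartedSpace (EuclideanSpace ℝ (Fin m)) M]
  {N : Type*} [TopologicalSpace N] [ChartedSpace (EuclideanSpace ℝ (Fin n)) N]

/-- The `c`-th coordinate of a tangent vector at `x`, in the preferred chart at `x`. -/
def tangentCoord {x : N} (c : Fin n) : TangentSpace (𝓡 n) x →L[ℝ] ℝ :=
  (EuclideanSpace.proj c : EuclideanSpace ℝ (Fin n) →L[ℝ] ℝ)

lemma tangentCoord_ext {x : N} {v w : TangentSpace (𝓡 n) x}
    (hvw : ∀ c, tangentCoord c v = tangentCoord c w) : v = w :=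
  WithLp.ofLp_injective 2 (funext hvw)

/-- In the charts at `x` and `ψ x`, the differential of `ψ` at `x` is its Jacobian matrix. -/
lemma mfderiv_apply_coord {ψ : M → N} {x : M} (hψ : MDifferentiableAt (𝓡 m) (𝓡 n) ψ x)
    (v : TangentSpace (𝓡 m) x) (c : Fin n) :
    tangentCoord c (mfderiv (𝓡 m) (𝓡 n) ψ x v) =
      ∑ k, tangentCoord k v * partialDeriv (localRep ψ x c) k (extChartAt (𝓡 m) x x) := by
  have hd := hψ.differentiableWithinAt_writtenInExtChartAt
  have hm : mfderiv (𝓡 m) (𝓡 n) ψ x = fderivWithin ℝ (writtenInExtChartAt (𝓡 m) (𝓡 n) x ψ)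
      (Set.range (𝓡 m)) (extChartAt (𝓡 m) x x) := by
    exact hψ.mfderiv
  rw [modelWithCornersSelf_coe, Set.range_id] at hd hm
  rw [fderivWithin_univ] at hm
  rw [differentiableWithinAt_univ] at hd
  have hp : ∀ w, fderiv ℝ (localRep ψ x c) (extChartAt (𝓡 m) x x) w =
      (fderiv ℝ (writtenInExtChartAt (𝓡 m) (𝓡 n) x ψ) (extChartAt (𝓡 m) x x) w :
        EuclideanSpace ℝ (Fin n)) c := by
    intro w
    have := ((EuclideanSpace.proj (𝕜 := ℝ) c).hasFDerivAt.comp _ hd.hasFDerivAt).fderiv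
    exact congrArg (fun D => D w) this
  rw [hm]
  refine (hp v).symm.trans ?_
  have hv : ∑ k, tangentCoord k v • stdVec m k = (v : EuclideanSpace ℝ (Fin m)) :=
    sum_smul_stdVec _
  have hsum := congrArg (fderiv ℝ (localRep ψ x c) (extChartAt (𝓡 m) x x)) hv
  rw [map_sum] at hsum
  refine hsum.symm.trans (Finset.sum_congr rfl fun k _ => ?_)
  rw [map_smul, smul_eq_mul, partialDeriv]

lemma mfderiv_real_apply_tangentVec {f : M → ℝ} {x : M}
    (hf : MDifferentiableAt (𝓡 m) 𝓘(ℝ, ℝ) f x) (i : Fin m) :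
    (show ℝ from mfderiv (𝓡 m) 𝓘(ℝ, ℝ) f x (tangentVec x i)) =
      partialDeriv (f ∘ (extChartAt (𝓡 m) x).symm) i (extChartAt (𝓡 m) x x) := by
  have hm : mfderiv (𝓡 m) 𝓘(ℝ, ℝ) f x = fderivWithin ℝ (writtenInExtChartAt (𝓡 m) 𝓘(ℝ, ℝ) x f)
      (Set.range (𝓡 m)) (extChartAt (𝓡 m) x x) := by
    exact hf.mfderiv
  rw [modelWithCornersSelf_coe, Set.range_id, fderivWithin_univ] at hm
  rw [hm]
  rfl

lemma differentiableAt_comp_extChartAt_symm {f : M → ℝ} {x : M}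
    (hf : MDifferentiableAt (𝓡 m) 𝓘(ℝ, ℝ) f x) :
    DifferentiableAt ℝ (f ∘ (extChartAt (𝓡 m) x).symm) (extChartAt (𝓡 m) x x) := by
  have hd := hf.differentiableWithinAt_writtenInExtChartAt
  rw [modelWithCornersSelf_coe, Set.range_id, differentiableWithinAt_univ] at hd
  exact hd

variable [IsManifold (𝓡 m) ∞ M] [IsManifold (𝓡 n) ∞ N]

lemma partialDeriv_mul {a b : EuclideanSpace ℝ (Fin m) → ℝ} {y : EuclideanSpace ℝ (Fin m)}
    (ha : DifferentiableAt ℝ a y) (hb : DifferentiableAt ℝ b y) (i : Fin m) :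
    partialDeriv (fun z => a z * b z) i y =
      partialDeriv a i y * b y + a y * partialDeriv b i y := by
  simp only [partialDeriv, fderiv_fun_mul ha hb]
  simp
  ring

lemma differentiableAt_chartGram (g : SmoothMetric m M) (x : M) (i j : Fin m) :
    DifferentiableAt ℝ (fun y => chartGram g x y i j) (extChartAt (𝓡 m) x x) :=
  ((contDiffOn_chartGram g x i j).contDiffAt ((isOpen_extChartAt_target x).mem_nhds
    (mem_extChartAt_target x))).differentiableAt (by simp)

/-- Up to the factor `1 / (2 f)`, the difference of the Christoffel symbols is
`∂ᵢf δᵏⱼ + ∂ⱼf δᵏᵢ - gᵢⱼ gᵏˡ ∂ₗf`. -/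
lemma christoffel_conformal {g g' : SmoothMetric m M} {f : M → ℝ}
    (hg : ∀ x (v w : TangentSpace (𝓡 m) x), g'.inner x v w = f x * g.inner x v w)
    (hf : ∀ x, 0 < f x) {x : M} (hfd : MDifferentiableAt (𝓡 m) 𝓘(ℝ, ℝ) f x) (k i j : Fin m) :
    christoffel g' x (extChartAt (𝓡 m) x x) k i j =
      christoffel g x (extChartAt (𝓡 m) x x) k i j + 1 / (2 * f x) * ∑ l, (gram g x)⁻¹ k l *
        (partialDeriv (f ∘ (extChartAt (𝓡 m) x).symm) i (extChartAt (𝓡 m) x x) * gram g x j l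
          + partialDeriv (f ∘ (extChartAt (𝓡 m) x).symm) j (extChartAt (𝓡 m) x x) * gram g x i l
          - partialDeriv (f ∘ (extChartAt (𝓡 m) x).symm) l (extChartAt (𝓡 m) x x)
            * gram g x i j) := by
  have h0 := (hf x).ne'
  have hP : ∀ a b c, partialDeriv (fun z => chartGram g' x z a b) c (extChartAt (𝓡 m) x x) =
      partialDeriv (f ∘ (extChartAt (𝓡 m) x).symm) c (extChartAt (𝓡 m) x x) * gram g x a b +
        f x * partialDeriv (fun z => chartGram g x z a b) c (extChartAt (𝓡 m) x x) := by
    intro a b c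
    have h1 : (fun z => chartGram g' x z a b) =
        fun z => (f ∘ (extChartAt (𝓡 m) x).symm) z * chartGram g x z a b := by
      funext z
      rw [chartGram_conformal hg]
      rfl
    rw [h1, partialDeriv_mul (differentiableAt_comp_extChartAt_symm hfd)
      (differentiableAt_chartGram g x a b), chartGram_self, Function.comp_apply,
      extChartAt_to_inv]
  simp only [christoffel, hP, chartGram_self, gram_conformal hg,
    inv_smul_matrix h0 (gram_posDef g x).det_pos.ne', Matrix.smul_apply, smul_eq_mul,
    Finset.mul_sum]
  rw [← Finset.sum_add_distrib]
  refine Finset.sum_congr rfl fun l _ => ?_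
  field_simp
  ring

/-- The trace of the difference of the Levi-Civita connections of conformal metrics. -/
lemma sum_inv_mul_sum_inv {G : Matrix (Fin m) (Fin m) ℝ} (hG : G.PosDef) (L : Fin m → ℝ)
    (k : Fin m) :
    ∑ i, ∑ j, G⁻¹ i j * ∑ l, G⁻¹ k l * (L i * G j l + L j * G i l - L l * G i j) =
      (2 - (m : ℝ)) * ∑ l, G⁻¹ k l * L l := by
  have hu : IsUnit G.det := hG.det_pos.ne'.isUnit
  have hs : ∀ i j, G i j = G j i := fun i j => by simpa using (hG.1.apply i j).symm
  have his : ∀ i j, G⁻¹ i j = G⁻¹ j i := fun i j => by simpa using (hG.inv.1.apply i j).symm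
  have h1 : ∀ i j, ∑ l, G⁻¹ i l * G l j = if i = j then 1 else 0 := fun i j => by
    rw [← Matrix.mul_apply, Matrix.nonsing_inv_mul _ hu, Matrix.one_apply]
  have h2 : ∀ i j, ∑ l, G⁻¹ k l * (L i * G j l + L j * G i l - L l * G i j) =
      L i * (if k = j then 1 else 0) + L j * (if k = i then 1 else 0)
        - G i j * ∑ l, G⁻¹ k l * L l := by
    intro i j
    rw [← h1, ← h1, Finset.mul_sum, Finset.mul_sum, Finset.mul_sum, ← Finset.sum_add_distrib,
      ← Finset.sum_sub_distrib]
    refine Finset.sum_congr rfl fun l _ => ?_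
    rw [hs j l, hs i l]
    ring
  -- The trace of the metric produces the dimension.
  have h3 : ∑ i, ∑ j, G⁻¹ i j * G i j = (m : ℝ) := by
    have : ∀ i, ∑ j, G⁻¹ i j * G i j = 1 := fun i => by
      simp_rw [hs i]
      simp [h1]
    simp [this]
  have h4 : ∑ i, ∑ j, G⁻¹ i j * L i * (if k = j then (1 : ℝ) else 0) = ∑ l, G⁻¹ k l * L l := by
    simp only [mul_ite, mul_one, mul_zero, Finset.sum_ite_eq, Finset.mem_univ, if_true, his k]
  have h5 : ∑ i, ∑ j, G⁻¹ i j * L j * (if k = i then (1 : ℝ) else 0) = ∑ l, G⁻¹ k l * L l := by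
    rw [Finset.sum_comm]
    simp
  calc _ = ∑ i, ∑ j, (G⁻¹ i j * L i * (if k = j then (1 : ℝ) else 0)
        + G⁻¹ i j * L j * (if k = i then (1 : ℝ) else 0)
        - G⁻¹ i j * G i j * ∑ l, G⁻¹ k l * L l) :=
        Finset.sum_congr rfl fun i _ => Finset.sum_congr rfl fun j _ => by rw [h2]; ring
    _ = _ := by
        simp only [Finset.sum_sub_distrib, Finset.sum_add_distrib, h4, h5]
        simp only [← Finset.sum_mul, h3]
        ring

/-- In coordinates, `f τ_{fg}(ψ) = τ_g(ψ) + (m - 2) / (2 f) dψ(grad_g f)`. -/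
lemma tension_conformal {g g' : SmoothMetric m M} {f : M → ℝ}
    (hg : ∀ x (v w : TangentSpace (𝓡 m) x), g'.inner x v w = f x * g.inner x v w)
    (hf : ∀ x, 0 < f x) (h : SmoothMetric n N) (ψ : M → N) {x : M}
    (hfd : MDifferentiableAt (𝓡 m) 𝓘(ℝ, ℝ) f x) (c : Fin n) :
    f x * tangentCoord c (tension g' h ψ x) =
      tangentCoord c (tension g h ψ x) +
        ((m : ℝ) - 2) / (2 * f x) * ∑ k, (∑ l, (gram g x)⁻¹ k l *
          partialDeriv (f ∘ (extChartAt (𝓡 m) x).symm) l (extChartAt (𝓡 m) x x)) *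
          partialDeriv (localRep ψ x c) k (extChartAt (𝓡 m) x x) := by
  have h0 := (hf x).ne'
  set P := fun k => partialDeriv (localRep ψ x c) k (extChartAt (𝓡 m) x x)
  set L := fun l => partialDeriv (f ∘ (extChartAt (𝓡 m) x).symm) l (extChartAt (𝓡 m) x x)
  set G := gram g x
  change f x * ∑ i, ∑ j, (gram g' x)⁻¹ i j * secondFundForm g' h ψ x c i j =
    (∑ i, ∑ j, G⁻¹ i j * secondFundForm g h ψ x c i j) + _
  have h1 : ∀ i j, secondFundForm g' h ψ x c i j = secondFundForm g h ψ x c i j -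
      1 / (2 * f x) * ∑ k, (∑ l, G⁻¹ k l * (L i * G j l + L j * G i l - L l * G i j)) * P k := by
    intro i j
    simp only [secondFundForm, christoffel_conformal hg hf hfd, add_mul, Finset.sum_add_distrib,
      mul_assoc, ← Finset.mul_sum]
    ring
  set X := fun i j k => ∑ l, G⁻¹ k l * (L i * G j l + L j * G i l - L l * G i j) with hX
  have h2 : ∑ i, ∑ j, G⁻¹ i j * ∑ k, X i j k * P k =
      (2 - (m : ℝ)) * ∑ k, (∑ l, G⁻¹ k l * L l) * P k := by
    calc _ = ∑ k, (∑ i, ∑ j, G⁻¹ i j * X i j k) * P k := by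
          simp only [Finset.mul_sum, Finset.sum_mul, mul_assoc]
          exact (Finset.sum_congr rfl fun i _ => Finset.sum_comm).trans Finset.sum_comm
      _ = _ := by
          rw [Finset.mul_sum]
          exact Finset.sum_congr rfl fun k _ => by
            rw [hX, sum_inv_mul_sum_inv (gram_posDef g x) L, mul_assoc]
  calc _ = ∑ i, ∑ j, (G⁻¹ i j * secondFundForm g h ψ x c i j -
        1 / (2 * f x) * (G⁻¹ i j * ∑ k, X i j k * P k)) := by
        rw [Finset.mul_sum]
        refine Finset.sum_congr rfl fun i _ => ?_
        rw [Finset.mul_sum]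
        refine Finset.sum_congr rfl fun j _ => ?_
        rw [h1, gram_conformal hg, inv_smul_matrix h0 (gram_posDef g x).det_pos.ne',
          Matrix.smul_apply, smul_eq_mul]
        change f x * ((f x)⁻¹ * G⁻¹ i j * (_ - 1 / (2 * f x) * ∑ k, X i j k * P k)) = _
        field_simp
    _ = _ := by
        simp only [Finset.sum_sub_distrib, ← Finset.mul_sum, h2]
        ring

/-- The chain rule `∂ₗ(f^q) = q f^q / f ∂ₗf`. -/
lemma partialDeriv_rpow {l : EuclideanSpace ℝ (Fin m) → ℝ} {y : EuclideanSpace ℝ (Fin m)}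
    (hl : DifferentiableAt ℝ l y) (h0 : 0 < l y) (q : ℝ) (i : Fin m) :
    partialDeriv (fun z => l z ^ q) i y = q * l y ^ q / l y * partialDeriv l i y := by
  have := (hl.hasFDerivAt.rpow_const (p := q) (Or.inl h0.ne')).fderiv
  simp only [partialDeriv, this, smul_apply, smul_eq_mul, Real.rpow_sub_one h0.ne']
  ring

/-- With `F = f ^ ((m - 2) / 2)`, the field `F τ_g(ψ) + dψ(grad_g F)` is a positive multiple of the
tension field for the metric `f g`. -/
lemma smul_tension_add_mfderiv_grad {g g' : SmoothMetric m M} {f : M → ℝ}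
    (hg : ∀ x (v w : TangentSpace (𝓡 m) x), g'.inner x v w = f x * g.inner x v w)
    (hf : ∀ x, 0 < f x) (hfs : ContMDiff (𝓡 m) 𝓘(ℝ, ℝ) ∞ f) (h : SmoothMetric n N) {ψ : M → N}
    {x : M} (hψ : MDifferentiableAt (𝓡 m) (𝓡 n) ψ x) :
    f x ^ (((m : ℝ) - 2) / 2) • tension g h ψ x +
        mfderiv (𝓡 m) (𝓡 n) ψ x (grad g (fun z => f z ^ (((m : ℝ) - 2) / 2)) x) =
      (f x ^ (((m : ℝ) - 2) / 2) * f x) • tension g' h ψ x := by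
  have hfd : MDifferentiableAt (𝓡 m) 𝓘(ℝ, ℝ) f x := hfs.mdifferentiableAt (by simp)
  set q := ((m : ℝ) - 2) / 2 with hq
  have hFd : MDifferentiableAt (𝓡 m) 𝓘(ℝ, ℝ) (fun z => f z ^ q) x := by
    have h1 : ContDiffAt ℝ ∞ (fun t : ℝ => t ^ q) (f x) :=
      Real.contDiffAt_rpow_const_of_ne (hf x).ne'
    exact (h1.contMDiffAt.comp x hfs.contMDiffAt).mdifferentiableAt (by simp)
  refine tangentCoord_ext fun c => ?_
  rw [map_add, map_smul, map_smul, smul_eq_mul, smul_eq_mul]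
  have hgrad : ∀ k, tangentCoord k (grad g (fun z => f z ^ q) x) =
      q * f x ^ q / f x * ∑ l, (gram g x)⁻¹ k l *
        partialDeriv (f ∘ (extChartAt (𝓡 m) x).symm) l (extChartAt (𝓡 m) x x) := by
    intro k
    have hs : ∀ i j, (gram g x)⁻¹ i j = (gram g x)⁻¹ j i := fun i j => by
      simpa using ((gram_posDef g x).inv.1.apply i j).symm
    have hv : ∀ j, tangentCoord k (tangentVec x j) = if k = j then (1 : ℝ) else 0 := fun j => by
      change stdVec m j k = _
      simp [stdVec]
    have hF : ∀ i, (show ℝ from mfderiv (𝓡 m) 𝓘(ℝ, ℝ) (fun z => f z ^ q) x (tangentVec x i)) =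
        q * f x ^ q / f x *
          partialDeriv (f ∘ (extChartAt (𝓡 m) x).symm) i (extChartAt (𝓡 m) x x) := fun i => by
      have h1 := partialDeriv_rpow (differentiableAt_comp_extChartAt_symm hfd) (hf _) q i
      rw [Function.comp_apply, extChartAt_to_inv] at h1
      exact (mfderiv_real_apply_tangentVec hFd i).trans h1
    simp only [grad, map_sum, map_smul, hv, smul_eq_mul, mul_ite, mul_one, mul_zero,
      Finset.sum_ite_eq, Finset.mem_univ, if_true, Finset.mul_sum]
    refine Finset.sum_congr rfl fun i _ => ?_
    rw [hs i k]
    refine (congrArg (_ * ·) (hF i)).trans ?_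
    ring
  rw [mul_assoc, tension_conformal hg hf h ψ hfd, mfderiv_apply_coord hψ, mul_add]
  congr 1
  have h0 := (hf x).ne'
  rw [Finset.mul_sum, Finset.mul_sum]
  refine Finset.sum_congr rfl fun k _ => ?_
  rw [hgrad]
  rw [hq]
  field_simp

end Tension

/-! ### First variation of the energies -/

section Variation

variable {m n : ℕ}
  {M : Type*} [TopologicalSpace M] [ChartedSpace (EuclideanSpace ℝ (Fin m)) M]

/-- A family of functions on `M`, indexed by `t ∈ (-ε, ε)`, that is smooth in `t` and in the
coordinates of every chart of `M`. -/
def SmoothFamily (m : ℕ) {M : Type*} [TopologicalSpace M]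
    [ChartedSpace (EuclideanSpace ℝ (Fin m)) M] (ε : ℝ) (u : ℝ → M → ℝ) : Prop :=
  ∀ p : M, ContDiffOn ℝ ∞ (fun z : ℝ × EuclideanSpace ℝ (Fin m) =>
    u z.1 ((extChartAt (𝓡 m) p).symm z.2)) (Set.Ioo (-ε) ε ×ˢ (extChartAt (𝓡 m) p).target)

namespace SmoothFamily

variable {ε : ℝ} {u : ℝ → M → ℝ}

lemma continuous (hu : SmoothFamily m ε u) {t : ℝ} (ht : t ∈ Set.Ioo (-ε) ε) :
    Continuous (u t) := by
  refine continuous_iff_continuousAt.2 fun x₀ => ?_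
  have h1 := (hu x₀).continuousOn.continuousAt (x := (t, extChartAt (𝓡 m) x₀ x₀))
    ((isOpen_Ioo.prod (isOpen_extChartAt_target x₀)).mem_nhds ⟨ht, mem_extChartAt_target x₀⟩)
  have h2 : ContinuousAt (fun x => (t, extChartAt (𝓡 m) x₀ x)) x₀ :=
    continuousAt_const.prodMk (continuousAt_extChartAt x₀)
  refine (ContinuousAt.comp (x := x₀) h1 h2).congr ?_
  filter_upwards [extChartAt_source_mem_nhds (I := 𝓡 m) x₀] with x hx
  simp only [Function.comp, (extChartAt (𝓡 m) x₀).left_inv hx]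

lemma hasDerivAt (hu : SmoothFamily m ε u) {t : ℝ} (ht : t ∈ Set.Ioo (-ε) ε) {p x : M}
    (hx : x ∈ (extChartAt (𝓡 m) p).source) :
    HasDerivAt (fun s => u s x) (fderiv ℝ (fun z : ℝ × EuclideanSpace ℝ (Fin m) =>
      u z.1 ((extChartAt (𝓡 m) p).symm z.2)) (t, extChartAt (𝓡 m) p x) (1, 0)) t := by
  have h1 := (((hu p).contDiffAt (x := (t, extChartAt (𝓡 m) p x))
    ((isOpen_Ioo.prod (isOpen_extChartAt_target p)).mem_nhds
    ⟨ht, (extChartAt (𝓡 m) p).map_source hx⟩)).differentiableAt (by simp)).hasFDerivAt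
  have h2 : HasDerivAt (fun s : ℝ => (s, extChartAt (𝓡 m) p x)) (1, 0) t :=
    (hasDerivAt_id t).prodMk (hasDerivAt_const t _)
  have h3 := h1.comp_hasDerivAt t h2
  simpa only [Function.comp_def, (extChartAt (𝓡 m) p).left_inv hx] using h3

lemma continuousAt_fderiv (hu : SmoothFamily m ε u) {t : ℝ} (ht : t ∈ Set.Ioo (-ε) ε) (p : M) :
    ContinuousAt (fun z : ℝ × M => fderiv ℝ (fun z : ℝ × EuclideanSpace ℝ (Fin m) =>
      u z.1 ((extChartAt (𝓡 m) p).symm z.2)) (z.1, extChartAt (𝓡 m) p z.2) (1, 0)) (t, p) := by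
  have hopen := isOpen_Ioo.prod (isOpen_extChartAt_target (I := 𝓡 m) p) (s := Set.Ioo (-ε) ε)
  have h1 := ((hu p).continuousOn_fderiv_of_isOpen hopen (by simp)).continuousAt
    (hopen.mem_nhds (x := (t, extChartAt (𝓡 m) p p)) ⟨ht, mem_extChartAt_target p⟩)
  have h2 : ContinuousAt (fun z : ℝ × M => (z.1, extChartAt (𝓡 m) p z.2)) (t, p) :=
    continuousAt_fst.prodMk (ContinuousAt.comp (x := (t, p)) (continuousAt_extChartAt p)
      continuousAt_snd)
  exact (ContinuousAt.comp (x := (t, p)) h1 h2).clm_apply continuousAt_const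

lemma continuous_deriv (hu : SmoothFamily m ε u) {t : ℝ} (ht : t ∈ Set.Ioo (-ε) ε) :
    Continuous fun x => deriv (fun s => u s x) t := by
  refine continuous_iff_continuousAt.2 fun p => ?_
  have h2 : ContinuousAt (fun x : M => (t, x)) p := continuousAt_const.prodMk continuousAt_id
  refine (ContinuousAt.comp (x := p) (hu.continuousAt_fderiv ht p) h2).congr ?_
  filter_upwards [extChartAt_source_mem_nhds (I := 𝓡 m) p] with x hx
  exact (hu.hasDerivAt ht hx).deriv.symm

/-- On a compact manifold, the derivative in the parameter is bounded near parameter `0`, uniformly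
in the point. -/
lemma exists_bound_deriv [CompactSpace M] (hu : SmoothFamily m ε u) (hε : 0 < ε) :
    ∃ δ > 0, ∃ C, ∀ x, ∀ t ∈ Metric.ball (0 : ℝ) δ,
      DifferentiableAt ℝ (fun s => u s x) t ∧ |deriv (fun s => u s x) t| ≤ C := by
  have h0 : (0 : ℝ) ∈ Set.Ioo (-ε) ε := ⟨by linarith, hε⟩
  suffices h : ∃ δ > 0, ∃ C, ∀ x ∈ (Set.univ : Set M), ∀ t ∈ Metric.ball (0 : ℝ) δ,
      DifferentiableAt ℝ (fun s => u s x) t ∧ |deriv (fun s => u s x) t| ≤ C by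
    simpa using h
  refine isCompact_univ.induction_on (p := fun S => ∃ δ > 0, ∃ C, ∀ x ∈ S,
    ∀ t ∈ Metric.ball (0 : ℝ) δ,
      DifferentiableAt ℝ (fun s => u s x) t ∧ |deriv (fun s => u s x) t| ≤ C) ?_ ?_ ?_ ?_
  · exact ⟨1, one_pos, 0, by simp⟩
  · rintro S S' hS ⟨δ, hδ, C, h⟩
    exact ⟨δ, hδ, C, fun x hx => h x (hS hx)⟩
  · rintro S S' ⟨δ, hδ, C, h⟩ ⟨δ', hδ', C', h'⟩
    refine ⟨min δ δ', lt_min hδ hδ', max C C', fun x hx t ht => ?_⟩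
    rcases hx with hx | hx
    · have := h x hx t (Metric.ball_subset_ball (min_le_left _ _) ht)
      exact ⟨this.1, this.2.trans (le_max_left _ _)⟩
    · have := h' x hx t (Metric.ball_subset_ball (min_le_right _ _) ht)
      exact ⟨this.1, this.2.trans (le_max_right _ _)⟩
  · intro p _
    obtain ⟨C, h1⟩ : ∃ C, ∀ᶠ z : ℝ × M in nhds (0, p),
        |fderiv ℝ (fun z : ℝ × EuclideanSpace ℝ (Fin m) =>
          u z.1 ((extChartAt (𝓡 m) p).symm z.2)) (z.1, extChartAt (𝓡 m) p z.2) (1, 0)| < C :=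
      ⟨_, (hu.continuousAt_fderiv h0 p).abs.eventually_lt continuousAt_const (lt_add_one _)⟩
    have h2 : ∀ᶠ z : ℝ × M in nhds (0, p), z.1 ∈ Set.Ioo (-ε) ε ∧
        z.2 ∈ (extChartAt (𝓡 m) p).source :=
      (isOpen_Ioo.prod (isOpen_extChartAt_source p)).mem_nhds ⟨h0, mem_extChartAt_source p⟩
    have h3 := h1.and h2
    rw [nhds_prod_eq] at h3
    obtain ⟨A, hA, B, hB, hAB⟩ := Filter.mem_prod_iff.1 h3
    obtain ⟨δ, hδ, hδA⟩ := Metric.mem_nhds_iff.1 hA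
    refine ⟨B, mem_nhdsWithin_of_mem_nhds hB, δ, hδ, C, fun x hx t ht => ?_⟩
    obtain ⟨h4, h5, h6⟩ := hAB (Set.mk_mem_prod (hδA ht) hx)
    have h7 := hu.hasDerivAt h5 h6
    exact ⟨h7.differentiableAt, by rw [h7.deriv]; exact h4.le⟩

/-- Differentiation under the integral sign on a compact manifold. -/
lemma hasDerivAt_integral [CompactSpace M] [MeasurableSpace M] [BorelSpace M]
    (hu : SmoothFamily m ε u) (hε : 0 < ε) (μ : Measure M) [IsFiniteMeasure μ] {w : M → ℝ}
    (hw : Continuous w) :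
    HasDerivAt (fun t => ∫ x, w x * u t x ∂μ) (∫ x, w x * deriv (fun s => u s x) 0 ∂μ) 0 := by
  have h0 : (0 : ℝ) ∈ Set.Ioo (-ε) ε := ⟨by linarith, hε⟩
  obtain ⟨δ, hδ, C, hC⟩ := hu.exists_bound_deriv hε
  obtain ⟨W, hW⟩ := isCompact_univ.exists_bound_of_continuousOn hw.continuousOn
  have hint : ∀ f : M → ℝ, Continuous f → Integrable f μ := by
    intro f hf
    obtain ⟨B, hB⟩ := isCompact_univ.exists_bound_of_continuousOn hf.continuousOn
    exact Integrable.of_bound hf.aestronglyMeasurable B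
      (Filter.Eventually.of_forall fun x => hB x trivial)
  refine (hasDerivAt_integral_of_dominated_loc_of_deriv_le (bound := fun _ => W * C)
    (F := fun t x => w x * u t x)
    (F' := fun (t : ℝ) x => w x * deriv (fun s => u s x) t) (Metric.ball_mem_nhds 0 hδ) ?_
    (hint _ (hw.mul (hu.continuous h0))) (hw.mul (hu.continuous_deriv h0)).aestronglyMeasurable
    ?_ (integrable_const _) ?_).2
  · filter_upwards [isOpen_Ioo.mem_nhds h0] with t ht
    exact (hw.mul (hu.continuous ht)).aestronglyMeasurable
  · refine Filter.Eventually.of_forall fun x t ht => ?_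
    rw [norm_mul]
    exact mul_le_mul (hW x trivial) (hC x t ht).2 (abs_nonneg _)
      ((norm_nonneg _).trans (hW x trivial))
  · exact Filter.Eventually.of_forall fun x t ht => (hC x t ht).1.hasDerivAt.const_mul _

end SmoothFamily

variable [IsManifold (𝓡 m) ∞ M]
  {N : Type*} [TopologicalSpace N] [ChartedSpace (EuclideanSpace ℝ (Fin n)) N]
  [IsManifold (𝓡 n) ∞ N]

lemma IsVariation.smoothFamily_normSqDiff (g : SmoothMetric m M) (h : SmoothMetric n N)
    {ψ : M → N} {ε : ℝ} {Ψ : ℝ × M → N} (hΨ : IsVariation m n ψ ε Ψ) :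
    SmoothFamily m ε fun t => normSqDiff g h fun x => Ψ (t, x) :=
  contDiffOn_normSqDiff g h isOpen_Ioo hΨ.smooth

variable [T2Space M] [CompactSpace M] [MeasurableSpace M] [BorelSpace M]

/-- The first variation of the `α`-energy, before integration by parts. -/
lemma IsVariation.hasDerivAt_alphaEnergy (g : SmoothMetric m M) (h : SmoothMetric n N)
    {ψ : M → N} {ε : ℝ} {Ψ : ℝ × M → N} (hΨ : IsVariation m n ψ ε Ψ) (α : ℝ) :
    HasDerivAt (fun t => alphaEnergy α g h fun x => Ψ (t, x))
      (∫ x, α * (1 + normSqDiff g h ψ x) ^ (α - 1) *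
        deriv (fun s => normSqDiff g h (fun x => Ψ (s, x)) x) 0 ∂(volumeMeasure g)) 0 := by
  have := isFiniteMeasure_volumeMeasure g
  have hpos : ∀ t x, 0 < 1 + normSqDiff g h (fun x => Ψ (t, x)) x := fun t x =>
    add_pos_of_pos_of_nonneg one_pos (normSqDiff_nonneg g h _ x)
  have hu : SmoothFamily m ε fun t x => (1 + normSqDiff g h (fun x => Ψ (t, x)) x) ^ α :=
    fun p => (contDiffOn_const.add (hΨ.smoothFamily_normSqDiff g h p)).rpow_const_of_ne
      fun z _ => (hpos _ _).ne'
  have h1 := hu.hasDerivAt_integral hΨ.pos (volumeMeasure g) (continuous_const (y := (1 : ℝ)))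
  simp only [one_mul] at h1
  refine h1.congr_deriv (integral_congr_ae (Filter.Eventually.of_forall fun x => ?_))
  have h0 : (0 : ℝ) ∈ Set.Ioo (-ε) ε := ⟨by linarith [hΨ.pos], hΨ.pos⟩
  have h2 := ((hΨ.smoothFamily_normSqDiff g h).hasDerivAt h0
    (mem_extChartAt_source (I := 𝓡 m) x)).differentiableAt.hasDerivAt
  have h3 := ((h2.const_add 1).rpow_const (p := α) (Or.inl (hpos 0 x).ne')).deriv
  simp only [hΨ.initial] at h3
  simp only
  rw [h3]
  ring

/-- With `F = f ^ ((m - 2) / 2)`, the energy for the metric `f g` is `1/2 ∫ F |dφ|² dV_g`. -/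
lemma energy_conformal {g g' : SmoothMetric m M} {f : M → ℝ}
    (hg : ∀ x (v w : TangentSpace (𝓡 m) x), g'.inner x v w = f x * g.inner x v w)
    (hf : ∀ x, 0 < f x) (hfc : Continuous f) (h : SmoothMetric n N) (φ : M → N) :
    energy g' h φ =
      ∫ x, 1 / 2 * f x ^ (((m : ℝ) - 2) / 2) * normSqDiff g h φ x ∂(volumeMeasure g) := by
  have hLm : Measurable fun x => ENNReal.ofReal (f x ^ ((m : ℝ) / 2)) :=
    (hfc.rpow_const fun x => Or.inl (hf x).ne').measurable.ennreal_ofReal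
  rw [energy, volumeMeasure_conformal hg hf hfc, integral_withDensity_eq_integral_toReal_smul hLm
    (Filter.Eventually.of_forall fun _ => ENNReal.ofReal_lt_top), ← integral_const_mul]
  refine integral_congr_ae (Filter.Eventually.of_forall fun x => ?_)
  have h1 : ((m : ℝ) - 2) / 2 = (m : ℝ) / 2 - 1 := by ring
  simp only [normSqDiff_conformal hg hf, smul_eq_mul, h1, Real.rpow_sub_one (hf x).ne',
    ENNReal.toReal_ofReal (Real.rpow_nonneg (hf x).le _)]
  ring

/-- If `f ^ ((m - 2) / 2) = 2 α (1 + |dψ|²) ^ (α - 1)`, then the `α`-energy for `g` and the energy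
for `f g` have the same derivative along every variation of `ψ`. -/
lemma isAlphaHarmonic_iff_isHarmonic {g g' : SmoothMetric m M} {f : M → ℝ}
    (hg : ∀ x (v w : TangentSpace (𝓡 m) x), g'.inner x v w = f x * g.inner x v w)
    (hf : ∀ x, 0 < f x) (hfc : Continuous f) (h : SmoothMetric n N) {ψ : M → N} {α : ℝ}
    (hfα : ∀ x, f x ^ (((m : ℝ) - 2) / 2) = 2 * α * (1 + normSqDiff g h ψ x) ^ (α - 1)) :
    IsAlphaHarmonic α g h ψ ↔ IsHarmonic g' h ψ := by
  have := isFiniteMeasure_volumeMeasure g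
  refine forall_congr' fun ε => forall_congr' fun Ψ => forall_congr' fun hΨ => ?_
  have h1 := hΨ.hasDerivAt_alphaEnergy g h α
  have hw : Continuous fun x => 1 / 2 * f x ^ (((m : ℝ) - 2) / 2) :=
    continuous_const.mul (hfc.rpow_const fun x => Or.inl (hf x).ne')
  have h2 := (hΨ.smoothFamily_normSqDiff g h).hasDerivAt_integral hΨ.pos (volumeMeasure g) hw
  simp only [← energy_conformal hg hf hfc h] at h2
  have h3 : ∫ x, 1 / 2 * f x ^ (((m : ℝ) - 2) / 2) *
      deriv (fun s => normSqDiff g h (fun x => Ψ (s, x)) x) 0 ∂(volumeMeasure g) =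
      ∫ x, α * (1 + normSqDiff g h ψ x) ^ (α - 1) *
        deriv (fun s => normSqDiff g h (fun x => Ψ (s, x)) x) 0 ∂(volumeMeasure g) := by
    refine integral_congr_ae (Filter.Eventually.of_forall fun x => ?_)
    simp only [hfα]
    ring
  rw [h3] at h2
  exact ⟨fun H => by rwa [h1.unique H] at h2, fun H => by rwa [h2.unique H] at h1⟩

end Variation

end AlphaHarmonic

end

theorem propositionj23 {m n : ℕ} (hm : 2 < m)
    {M : Type*} [TopologicalSpace M] [T2Space M] [CompactSpace M]
    [MeasurableSpace M] [BorelSpace M]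
    [ChartedSpace (EuclideanSpace ℝ (Fin m)) M] [IsManifold (𝓡 m) ∞ M]
    {N : Type*} [TopologicalSpace N] [T2Space N] [SecondCountableTopology N]
    [ChartedSpace (EuclideanSpace ℝ (Fin n)) N] [IsManifold (𝓡 n) ∞ N]
    (g : AlphaHarmonic.SmoothMetric m M) (h : AlphaHarmonic.SmoothMetric n N)
    (α : ℝ) (hα : 1 < α)
    (ψ : M → N) (hψ : ContMDiff (𝓡 m) (𝓡 n) ∞ ψ)
    (hnd : AlphaHarmonic.NonDegenerate m n ψ) :
    ∃ gbar : AlphaHarmonic.SmoothMetric m M,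
      (∀ (x : M) (v w : TangentSpace (𝓡 m) x),
        gbar.inner x v w =
          ((2 * α) ^ (2 / ((m : ℝ) - 2)) *
            (1 + AlphaHarmonic.normSqDiff g h ψ x) ^ ((2 * α - 2) / ((m : ℝ) - 2))) *
              g.inner x v w) ∧
      (AlphaHarmonic.IsAlphaHarmonic α g h ψ ↔ AlphaHarmonic.IsHarmonic gbar h ψ) ∧
      ((∀ x, AlphaHarmonic.alphaTension α g h ψ x = 0) ↔
        ∀ x, AlphaHarmonic.tension gbar h ψ x = 0) := by
  have hm2 : ((m : ℝ) - 2) ≠ 0 := sub_ne_zero.2 (by exact_mod_cast hm.ne')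
  have hα2 : 0 < 2 * α := by linarith
  have he : ∀ x, 0 < 1 + AlphaHarmonic.normSqDiff g h ψ x := fun x =>
    add_pos_of_pos_of_nonneg one_pos (AlphaHarmonic.normSqDiff_nonneg g h ψ x)
  set f : M → ℝ := fun x => (2 * α) ^ (2 / ((m : ℝ) - 2)) *
    (1 + AlphaHarmonic.normSqDiff g h ψ x) ^ ((2 * α - 2) / ((m : ℝ) - 2)) with hfdef
  have hfpos : ∀ x, 0 < f x := fun x =>
    mul_pos (Real.rpow_pos_of_pos hα2 _) (Real.rpow_pos_of_pos (he x) _)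
  have hfs : ContMDiff (𝓡 m) 𝓘(ℝ, ℝ) ∞ f := fun x => by
    have h1 : ContDiffAt ℝ ∞ (fun t : ℝ => (2 * α) ^ (2 / ((m : ℝ) - 2)) *
        (1 + t) ^ ((2 * α - 2) / ((m : ℝ) - 2))) (AlphaHarmonic.normSqDiff g h ψ x) :=
      contDiffAt_const.mul ((contDiffAt_const.add contDiffAt_id).rpow_const_of_ne (he x).ne')
    exact h1.contMDiffAt.comp x (AlphaHarmonic.contMDiff_normSqDiff g h hψ x)
  have hfα : ∀ x, f x ^ (((m : ℝ) - 2) / 2) =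
      2 * α * (1 + AlphaHarmonic.normSqDiff g h ψ x) ^ (α - 1) := fun x => by
    rw [hfdef, Real.mul_rpow (Real.rpow_nonneg hα2.le _) (Real.rpow_nonneg (he x).le _),
      ← Real.rpow_mul hα2.le, ← Real.rpow_mul (he x).le]
    have h1 : 2 / ((m : ℝ) - 2) * (((m : ℝ) - 2) / 2) = 1 := by field_simp
    have h2 : (2 * α - 2) / ((m : ℝ) - 2) * (((m : ℝ) - 2) / 2) = α - 1 := by field_simp
    rw [h1, h2, Real.rpow_one]
  set gbar := AlphaHarmonic.conformalMetric g f hfs hfpos with hgbar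
  have hg : ∀ x (v w : TangentSpace (𝓡 m) x), gbar.inner x v w = f x * g.inner x v w :=
    fun _ _ _ => rfl
  refine ⟨gbar, hg, AlphaHarmonic.isAlphaHarmonic_iff_isHarmonic hg hfpos hfs.continuous h hfα,
    forall_congr' fun x => ?_⟩
  have hτ := AlphaHarmonic.smul_tension_add_mfderiv_grad hg hfpos hfs h
    (hψ.mdifferentiable (by simp) x)
  simp only [hfα] at hτ
  rw [AlphaHarmonic.alphaTension, hτ, smul_eq_zero, or_iff_right]
  exact (mul_pos (mul_pos hα2 (Real.rpow_pos_of_pos (he x) _)) (hfpos x)).ne'
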